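/- Let $X$ be a homogeneous compact Hausdorff space (that is, for all $x,y\in X$ there is a homeomorphism $h\colon X\to X$ with $h(x)=y$). Call a topological space $Y$ countably tight if, for every $A\subseteq Y$ and every $x\in\overline{A}\setminus A$, there is a countable set $B\subseteq A$ with $x\in\overline{B}$. Suppose that $X$ is the union of countably many dense subspaces each of which is countably tight in its subspace topology, or that $X$ is the union of finitely many (not necessarily dense) subspaces each of which is countably tight in its subspace topology. Then $|X|\le 2^{\omega}$. -/

import Mathlib

/-- A topological space is homogeneous if any point can be mapped to any other point by a
homeomorphism of the space onto itself. -/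
def IsHomogeneousSpace (X : Type*) [TopologicalSpace X] : Prop :=
  ∀ x y : X, ∃ h : X ≃ₜ X, h x = y

/-- A topological space is countably tight if every point in the closure of a set `A` and outside
`A` is in the closure of some countable subset of `A`. -/
def IsCountablyTight (X : Type*) [TopologicalSpace X] : Prop :=
  ∀ (x : X) (A : Set X), x ∈ closure A \ A → ∃ B ⊆ A, B.Countable ∧ x ∈ closure B

/-! Two countability facts carry the proof. If no point had a countable local π-base, a recursion of
length ω₁ would give ℵ₁ independent pairs of open sets with disjoint closures. Splitting them into ω
columns and spending finitely many columns on each tight piece gives nonempty closed sets that avoid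
the pieces one after another, which compactness forbids
(`not_countably_tight_cover_of_independent`). So some point, and by homogeneity every point, has a
countable local π-base.

Then a free-sequence argument puts some nonempty Gδ set inside the closure of a countable set;
homogeneity moves such a set to each point. A closing-off argument with continuum many operations
now yields a dense set `D` of size at most 𝔠 (`IsTightCover.exists_dense_mk_le_continuum`). Moving
one countable π-base around by homeomorphisms encodes each point by a sequence in `D`, so |X| ≤ 𝔠^ω
= 𝔠.

Both forms of the hypothesis are reduced to `IsTightCover`; for finite covers, homogeneity supplies
the density locally. -/

section ClosingOff
open Set Filter Topology
open scoped Cardinal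

universe u
variable {X : Type u} [TopologicalSpace X]

/-- Countable tightness of a subspace, in terms of closures in the ambient space. -/
theorem IsCountablyTight.exists_countable_subset {Y A : Set X} (hY : IsCountablyTight Y)
    (hA : A ⊆ Y) {x : X} (hx : x ∈ Y) (hxA : x ∈ closure A) :
    ∃ B ⊆ A, B.Countable ∧ x ∈ closure B := by
  by_cases hmem : x ∈ A
  · exact ⟨{x}, by simpa using hmem, countable_singleton x, subset_closure rfl⟩
  · obtain ⟨B, hBA, hB, hxB⟩ := hY ⟨x, hx⟩ (Subtype.val ⁻¹' A)
      ⟨by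
        rw [closure_subtype, Subtype.image_preimage_coe, inter_eq_self_of_subset_right hA]
        exact hxA, hmem⟩
    exact ⟨Subtype.val '' B, by simpa using hBA, hB.image _, closure_subtype.1 hxB⟩

/-- Countable tightness is invariant under homeomorphisms of the ambient space. -/
theorem IsCountablyTight.image_homeomorph {Y : Set X} (hY : IsCountablyTight Y) (h : X ≃ₜ X) :
    IsCountablyTight (h '' Y) := by
  rintro ⟨x, y, hy, rfl⟩ A ⟨hxA, -⟩
  rw [closure_subtype] at hxA
  have hsub : h ⁻¹' (Subtype.val '' A) ⊆ Y := by
    rintro z ⟨a, -, ha⟩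
    obtain ⟨w, hw, hwa⟩ := a.2
    rwa [← h.injective (hwa.trans ha)]
  have hcl : y ∈ closure (h ⁻¹' (Subtype.val '' A)) := by
    rw [← h.preimage_closure]
    exact hxA
  obtain ⟨B, hBA, hB, hyB⟩ := hY.exists_countable_subset hsub hy hcl
  refine ⟨A ∩ Subtype.val ⁻¹' (h '' B), inter_subset_left,
    ((hB.image h).preimage Subtype.val_injective).mono inter_subset_right, ?_⟩
  rw [closure_subtype]
  have hBimg : h '' B ⊆ Subtype.val '' (A ∩ Subtype.val ⁻¹' (h '' B)) := by
    rintro _ ⟨b, hb, rfl⟩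
    obtain ⟨a, ha, hab⟩ := hBA hb
    exact ⟨a, ⟨ha, b, hb, hab.symm⟩, hab⟩
  refine closure_mono hBimg ?_
  rw [← h.image_closure]
  exact mem_image_of_mem _ hyB

theorem exists_uncountable_wellOrder :
    ∃ (ι : Type) (_ : LinearOrder ι) (_ : WellFoundedLT ι),
      #ι = ℵ₁ ∧ ∀ a : ι, (Iio a).Countable := by
  refine ⟨(ℵ₁ : Cardinal.{0}).ord.ToType, inferInstance, inferInstance,
    Cardinal.mk_ord_toType _, fun a ↦ ?_⟩
  have h : #(Iio a) < ℵ₁ := by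
    simpa using Cardinal.mk_Iio_lt a (by simp)
  rwa [← Cardinal.le_aleph0_iff_set_countable, ← not_lt, ← Cardinal.aleph_one_le_iff, not_le]

theorem Set.Countable.exists_forall_lt {ι : Type*} [LinearOrder ι] [Uncountable ι]
    (hι : ∀ a : ι, (Iio a).Countable) {s : Set ι} (hs : s.Countable) : ∃ b, ∀ a ∈ s, a < b := by
  have hc : (⋃ a ∈ s, Iic a).Countable := by
    refine hs.biUnion fun a _ ↦ ?_
    rw [← Iio_insert]
    exact (hι a).insert a
  by_contra! h
  refine not_countable_univ (hc.mono fun b _ ↦ ?_)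
  obtain ⟨a, ha, hba⟩ := h b
  exact mem_biUnion ha hba

/-- Transfinite recursion for a step that is given by a relation. -/
theorem exists_fun_of_step {ι P : Type*} [LinearOrder ι] [WellFoundedLT ι] [Nonempty P]
    (R : ι → (ι → P) → P → Prop)
    (hcongr : ∀ a g g', (∀ b < a, g b = g' b) → ∀ p, R a g p → R a g' p)
    (hstep : ∀ a g, ∃ p, R a g p) : ∃ f : ι → P, ∀ a, R a f (f a) := by
  classical
  choose step hs using hstep
  -- The value at and above `a` is junk; `hcongr` makes it irrelevant.
  let ext (a : ι) (g : ∀ b, b < a → P) (b : ι) : P :=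
    if h : b < a then g b h else Classical.arbitrary P
  let f : ι → P := (wellFounded_lt (α := ι)).fix fun a g ↦ step a (ext a g)
  refine ⟨f, fun a ↦ ?_⟩
  have hf : f a = step a (ext a fun b _ ↦ f b) := WellFounded.fix_eq _ _ _
  rw [hf]
  refine hcongr a _ _ (fun b hb ↦ ?_) _ (hs a _)
  simp [ext, hb]

/-! ### Independent families against countably tight covers -/

section Independent

variable {ι : Type*} [LinearOrder ι]

/-- The set `C` meets every intersection of an independent family of pairs, even after the first
`N` columns of the family are dropped. -/
def MeetsTails (F : ℕ → ι → Bool → Set X) (C : Set X) (N : ℕ) : Prop :=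
  ∀ ε : ℕ → ι → Bool, ∃ x ∈ C, ∀ n, N ≤ n → ∀ a, x ∈ F n a (ε n a)

/-- Column `N` is used to test `Y` with the patterns "true below `a`, false from `a` on". If all of
them are realized in `C ∩ Y`, compatibly with finitely many later choices, limits of the witnesses
are "true" everywhere in column `N`, but a countable set of witnesses is "false" at some common
index, so tightness keeps those limits out of `Y`. Otherwise an unrealized pattern cuts out a closed
set missing `Y` at the cost of finitely many columns. -/
theorem MeetsTails.exists_disjoint [CompactSpace X] [Uncountable ι]
    (hι : ∀ a : ι, (Iio a).Countable) {F : ℕ → ι → Bool → Set X}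
    (hF : ∀ n a e, IsClosed (F n a e)) (hd : ∀ n a, Disjoint (F n a false) (F n a true))
    {C : Set X} {N : ℕ} (hC : IsClosed C) (h : MeetsTails F C N) {Y : Set X}
    (hY : IsCountablyTight Y) :
    ∃ C' ⊆ C, ∃ N', IsClosed C' ∧ MeetsTails F C' N' ∧ Disjoint C' Y := by
  classical
  have hlt (a : ι) : ∃ b, a < b := by
    obtain ⟨b, hb⟩ := (countable_singleton a).exists_forall_lt hι
    exact ⟨b, hb a rfl⟩
  by_cases hcase : ∀ (a : ι) (ε : ℕ → ι → Bool) (t : Finset (ℕ × ι)), ∃ x ∈ C, x ∈ Y ∧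
      (∀ b, x ∈ F N b (decide (b < a))) ∧ ∀ i ∈ t, N < i.1 → x ∈ F i.1 i.2 (ε i.1 i.2)
  · choose y hyC hyY hyN hyt using hcase
    let A : Set X := {x | ∃ a ε t, x = y a ε t}
    refine ⟨C ∩ (closure A ∩ ⋂ b, F N b true), inter_subset_left, N + 1,
      hC.inter (isClosed_closure.inter (isClosed_iInter fun b ↦ hF _ _ _)), ?_, ?_⟩
    · intro ε
      let g : ι × Finset (ℕ × ι) → X := fun p ↦ y p.1 ε p.2
      have : Nonempty ι := inferInstance
      -- A limit along both `a` and `t` meets every closed condition that holds eventually.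
      let u : Ultrafilter (ι × Finset (ℕ × ι)) := Ultrafilter.of atTop
      obtain ⟨z, -, hz⟩ := isCompact_univ.ultrafilter_le_nhds (u.map g) (by simp)
      have key : ∀ S : Set X, IsClosed S → ∀ p, (∀ q, p ≤ q → g q ∈ S) → z ∈ S := by
        intro S hS p hp
        have hev : ∀ᶠ q in (u : Filter _), g q ∈ S :=
          Ultrafilter.of_le atTop ((eventually_ge_atTop p).mono hp)
        have hz' : Tendsto g u (𝓝 z) := hz
        exact hS.mem_of_tendsto hz' hev
      have p0 : ι × Finset (ℕ × ι) := (Classical.arbitrary ι, ∅)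
      refine ⟨z, ⟨key C hC p0 fun q _ ↦ hyC _ _ _, key _ isClosed_closure p0
        fun q _ ↦ subset_closure ⟨_, _, _, rfl⟩, mem_iInter.2 fun b ↦ ?_⟩, fun n hn a ↦ ?_⟩
      · obtain ⟨c, hc⟩ := hlt b
        refine key _ (hF _ _ _) (c, ∅) fun q hq ↦ ?_
        have := hyN q.1 ε q.2 b
        rwa [decide_eq_true (hc.trans_le hq.1)] at this
      · refine key _ (hF _ _ _) (p0.1, {(n, a)}) fun q hq ↦ ?_
        exact hyt q.1 ε q.2 (n, a) (hq.2 (by simp)) (by simpa using hn)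
    · rw [Set.disjoint_left]
      rintro z ⟨-, hzA, hzN⟩ hzY
      obtain ⟨B, hBA, hB, hzB⟩ := hY.exists_countable_subset
        (A := A) (by rintro _ ⟨a, ε, t, rfl⟩; exact hyY _ _ _) hzY hzA
      have hBA' : ∀ b ∈ B, ∃ a ε t, b = y a ε t := hBA
      choose! α ε t hα using hBA'
      obtain ⟨c, hc⟩ := (hB.image α).exists_forall_lt hι
      have hsub : B ⊆ F N c false := by
        intro b hb
        have := hyN (α b) (ε b) (t b) c
        rw [decide_eq_false (hc _ (mem_image_of_mem _ hb)).not_gt] at this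
        rw [hα b hb]
        exact this
      exact Set.disjoint_left.1 (hd N c) (closure_minimal hsub (hF _ _ _) hzB) (mem_iInter.1 hzN c)
  · push Not at hcase
    obtain ⟨a, ε, t, hcase⟩ := hcase
    let S : Set X := {x | (∀ b, x ∈ F N b (decide (b < a))) ∧
      ∀ i ∈ t, N < i.1 → x ∈ F i.1 i.2 (ε i.1 i.2)}
    have hS : IsClosed S := by
      simp only [S, ofPred_and, ofPred_forall]
      exact (isClosed_iInter fun b ↦ hF _ _ _).inter
        (isClosed_iInter fun i ↦ isClosed_iInter fun _ ↦ isClosed_iInter fun _ ↦ hF _ _ _)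
    refine ⟨C ∩ S, inter_subset_left, N + 1 + t.sup Prod.fst, hC.inter hS, fun ε' ↦ ?_, ?_⟩
    -- The columns mentioned by `t` follow the unrealized pattern; all later ones stay free for
    -- `ε'`.
    · obtain ⟨x, hxC, hx⟩ := h fun n b ↦ if n = N then decide (b < a) else
        if n < N + 1 + t.sup Prod.fst then ε n b else ε' n b
      refine ⟨x, ⟨hxC, fun b ↦ by simpa using hx N le_rfl b, fun i hi hNi ↦ ?_⟩, fun n hn b ↦ ?_⟩
      · have hle : i.1 ≤ t.sup Prod.fst := Finset.le_sup (f := Prod.fst) hi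
        have := hx i.1 hNi.le i.2
        rwa [if_neg hNi.ne', if_pos (by omega)] at this
      · have := hx n (by omega) b
        rwa [if_neg (by omega), if_neg (by omega)] at this
    · rw [Set.disjoint_left]
      rintro x ⟨hxC, hxN, hxt⟩ hxY
      obtain ⟨i, hi, hNi, hxi⟩ := hcase x hxC hxY hxN
      exact hxi (hxt i hi hNi)

/-- A compact space with an independent family of `ℵ₁` pairs of disjoint closed sets is not the
union of countably many countably tight subspaces. -/
theorem not_countably_tight_cover_of_independent [CompactSpace X] [Uncountable ι]
    (hι : ∀ a : ι, (Iio a).Countable) {F : ℕ → ι → Bool → Set X}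
    (hF : ∀ n a e, IsClosed (F n a e)) (hd : ∀ n a, Disjoint (F n a false) (F n a true))
    (h : MeetsTails F univ 0) (Y : ℕ → Set X) (hY : ∀ n, IsCountablyTight (Y n)) :
    ⋃ n, Y n ≠ univ := by
  intro hcover
  let T := {p : Set X × ℕ // IsClosed p.1 ∧ MeetsTails F p.1 p.2}
  have hstep : ∀ (n : ℕ) (p : T), ∃ q : T, q.1.1 ⊆ p.1.1 ∧ Disjoint q.1.1 (Y n) := by
    rintro n ⟨p, hp, hpF⟩
    obtain ⟨C', hC', N', h1, h2, h3⟩ := hpF.exists_disjoint hι hF hd hp (hY n)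
    exact ⟨⟨(C', N'), h1, h2⟩, hC', h3⟩
  choose next hsub hdisj using hstep
  let c : ℕ → T := fun n ↦ Nat.rec ⟨(univ, 0), isClosed_univ, h⟩ (fun n p ↦ next n p) n
  obtain ⟨x, hx⟩ := IsCompact.nonempty_iInter_of_sequence_nonempty_isCompact_isClosed
    (fun n ↦ (c n).1.1) (fun n ↦ hsub n (c n))
    (fun n ↦ by
      obtain ⟨x, hx, -⟩ := (c n).2.2 fun _ _ ↦ false
      exact ⟨x, hx⟩)
    (c 0).2.1.isCompact (fun n ↦ (c n).2.1)
  obtain ⟨n, hn⟩ := mem_iUnion.1 (hcover.symm ▸ mem_univ x)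
  exact Set.disjoint_left.1 (hdisj n (c n)) (mem_iInter.1 hx (n + 1)) hn

end Independent

end ClosingOff

/-! ### Existence of a point with a countable local π-base -/

section PiCharacter
open Set Filter Topology TopologicalSpace
open scoped Cardinal

universe u
variable {X : Type u} [TopologicalSpace X]

/-- The point `p` has a countable local π-base. -/
def HasCountableLocalPiBase (p : X) : Prop :=
  ∃ B : ℕ → Set X, (∀ k, IsOpen (B k) ∧ (B k).Nonempty) ∧
    ∀ V, IsOpen V → p ∈ V → ∃ k, B k ⊆ V

theorem exists_open_not_subset {p : X} (hp : ¬HasCountableLocalPiBase p) {J : Type*} [Countable J]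
    (B : J → Set X) (hB : ∀ j, IsOpen (B j)) :
    ∃ V, IsOpen V ∧ p ∈ V ∧ ∀ j, (B j).Nonempty → ¬B j ⊆ V := by
  by_contra! h
  refine hp ?_
  have hne : Nonempty {j // (B j).Nonempty} := by
    obtain ⟨j, hj, -⟩ := h univ isOpen_univ (mem_univ p)
    exact ⟨j, hj⟩
  obtain ⟨f, hf⟩ := exists_surjective_nat {j // (B j).Nonempty}
  refine ⟨fun k ↦ B (f k), fun k ↦ ⟨hB _, (f k).2⟩, fun V hV hpV ↦ ?_⟩
  obtain ⟨j, hj, hjV⟩ := h V hV hpV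
  obtain ⟨k, hk⟩ := hf ⟨j, hj⟩
  exact ⟨k, by simpa only [hk] using hjV⟩

variable {ι : Type*}

/-- The intersection of finitely many members of a family of pairs. -/
def cell (O : ι → Bool → Opens X) (d : Finset (ι × Bool)) : Set X :=
  ⋂ i ∈ d, (O i.1 i.2 : Set X)

theorem isOpen_cell (O : ι → Bool → Opens X) (d : Finset (ι × Bool)) : IsOpen (cell O d) :=
  isOpen_biInter_finset fun i _ ↦ (O i.1 i.2).isOpen

theorem cell_congr {O O' : ι → Bool → Opens X} {d : Finset (ι × Bool)}
    (h : ∀ i ∈ d, O i.1 = O' i.1) : cell O d = cell O' d :=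
  iInter₂_congr fun i hi ↦ by rw [h i hi]

/-- If no point has a countable local π-base, then below some cell of a countable family of pairs
there is a new pair that splits all cells. -/
theorem exists_splitting_pair [CompactSpace X] [T2Space X] [Nonempty X]
    (h : ∀ p : X, ¬HasCountableLocalPiBase p) {s : Set ι} (hs : s.Countable)
    (O : ι → Bool → Opens X) :
    ∃ e : Finset (ι × Bool), (∀ i ∈ e, i.1 ∈ s) ∧ (cell O e).Nonempty ∧
      ∃ P : Bool → Opens X, Disjoint (closure (P false : Set X)) (closure (P true)) ∧
        ∀ d : Finset (ι × Bool), (∀ i ∈ d, i.1 ∈ s) → e ⊆ d → (cell O d).Nonempty →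
          ∀ b, (cell O d ∩ P b).Nonempty := by
  classical
  let J := {d : Finset (ι × Bool) // ∀ i ∈ d, i.1 ∈ s}
  have hJ : Countable J := by
    have : Countable (s ×ˢ (univ : Set Bool) : Set (ι × Bool)) :=
      (hs.prod countable_univ).to_subtype
    let f : J → Finset (s ×ˢ (univ : Set Bool) : Set (ι × Bool)) := fun d ↦
      d.1.subtype (· ∈ s ×ˢ (univ : Set Bool))
    refine Function.Injective.countable (f := f) fun d d' hdd ↦ Subtype.ext ?_
    have := congrArg (Finset.map (Function.Embedding.subtype _)) hdd
    simp only [f, Finset.subtype_map] at this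
    rwa [Finset.filter_true_of_mem fun i hi ↦ ⟨d.2 i hi, mem_univ _⟩,
      Finset.filter_true_of_mem fun i hi ↦ ⟨d'.2 i hi, mem_univ _⟩] at this
  -- Countably many cells are no π-base at `p`, so `V p` contains no nonempty cell. If no pair
  -- splits, the pair `W' p`, `(closure (W p))ᶜ` fails below each nonempty cell: a subcell avoids
  -- one side. It cannot avoid the second, as it would lie in `V p`; so it avoids `W' p`. Finitely
  -- many `W' p` cover the space.
  choose V hV hpV hBV using fun p ↦
    exists_open_not_subset (h p) (fun d : J ↦ cell O d.1) fun d ↦ isOpen_cell O d.1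
  have hsh : ∀ p : X, ∃ W : Set X, IsOpen W ∧ p ∈ W ∧ closure W ⊆ V p := fun p ↦ by
    obtain ⟨W, hW, hpW, hWV⟩ := normal_exists_closure_subset isClosed_singleton (hV p)
      (singleton_subset_iff.2 (hpV p))
    exact ⟨W, hW, hpW rfl, hWV⟩
  choose W hW hpW hWV using hsh
  have hsh' : ∀ p : X, ∃ W' : Set X, IsOpen W' ∧ p ∈ W' ∧ closure W' ⊆ W p := fun p ↦ by
    obtain ⟨W', hW', hpW', hWW'⟩ := normal_exists_closure_subset isClosed_singleton (hW p)
      (singleton_subset_iff.2 (hpW p))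
    exact ⟨W', hW', hpW' rfl, hWW'⟩
  choose W' hW' hpW' hWW' using hsh'
  by_contra! hcon
  have hsplit : ∀ (e : J) (p : X), (cell O e.1).Nonempty →
      ∃ d : J, e.1 ⊆ d.1 ∧ (cell O d.1).Nonempty ∧ Disjoint (cell O d.1) (W' p) := by
    intro e p he
    obtain ⟨d, hds, hed, hd, b, hb⟩ := hcon e.1 e.2 he
      (fun b ↦ bif b then ⟨(closure (W p))ᶜ, isClosed_closure.isOpen_compl⟩ else ⟨W' p, hW' p⟩) (by
        refine Disjoint.mono (hWW' p) (closure_minimal (t := (W p)ᶜ) ?_ (hW p).isClosed_compl)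
          disjoint_compl_right
        exact compl_subset_compl.2 subset_closure)
    cases b with
    | false => exact ⟨⟨d, hds⟩, hed, hd, disjoint_iff_inter_eq_empty.2 hb⟩
    | true =>
      refine absurd ?_ (hBV p ⟨d, hds⟩ hd)
      refine Subset.trans ?_ (hWV p)
      exact disjoint_compl_right_iff_subset.1 (disjoint_iff_inter_eq_empty.2 hb)
  have hfin : ∀ t : Finset X, ∃ d : J, (cell O d.1).Nonempty ∧
      ∀ p ∈ t, Disjoint (cell O d.1) (W' p) := by
    intro t
    induction t using Finset.induction_on with
    | empty => exact ⟨⟨∅, by simp⟩, by simp [cell], by simp⟩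
    | insert p t _ ih =>
      obtain ⟨d, hd, hdt⟩ := ih
      obtain ⟨d', hdd', hd', hd'p⟩ := hsplit d p hd
      refine ⟨d', hd', fun q hq ↦ ?_⟩
      rcases Finset.mem_insert.1 hq with rfl | hq
      · exact hd'p
      · exact (hdt q hq).mono_left (biInter_subset_biInter_left hdd')
  obtain ⟨t, ht⟩ := CompactSpace.elim_nhds_subcover W' fun p ↦ (hW' p).mem_nhds (hpW' p)
  obtain ⟨d, ⟨x, hx⟩, hd⟩ := hfin t
  obtain ⟨p, hp, hxp⟩ := mem_iUnion₂.1 (ht.symm ▸ mem_univ x : x ∈ ⋃ p ∈ t, W' p)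
  exact Set.disjoint_left.1 (hd p hp) hx hxp

variable [LinearOrder ι] [WellFoundedLT ι]

/-- A regressive function to finite subsets is constant on an uncountable set. -/
theorem exists_uncountable_fiber [Uncountable ι]
    {β : Type*} [Countable β] (e : ι → Finset (ι × β))
    (he : ∀ a, ∀ i ∈ e a, i.1 < a) : ∃ e₀, ¬(e ⁻¹' {e₀}).Countable := by
  classical
  by_contra! h
  -- A pressing-down argument: with countable fibers, closing off under `next` stays countable, and
  -- the least index `c` outside has `e c` inside some stage, so it belongs to the next one.
  let next : Set ι → Set ι := fun s ↦ ⋃ t ∈ {t : Finset (ι × β) | (t : Set (ι × β)) ⊆ s ×ˢ univ},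
    e ⁻¹' {t}
  have hnext : ∀ s : Set ι, s.Countable → (next s).Countable := fun s hs ↦ by
    refine Countable.biUnion ?_ fun t _ ↦ h t
    refine ((countable_ofPred_finite_subset (hs.prod countable_univ)).preimage
      Finset.coe_injective).mono ?_
    intro t ht
    exact ⟨t.finite_toSet, ht⟩
  let C : ℕ → Set ι := fun n ↦ Nat.rec ∅ (fun _ s ↦ s ∪ next s) n
  have hC : ∀ n, (C n).Countable := fun n ↦ by
    induction n with
    | zero => exact countable_empty
    | succ n ih => exact ih.union (hnext _ ih)
  have hmono : Monotone C := monotone_nat_of_le_succ fun n ↦ subset_union_left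
  have hne : (⋃ n, C n)ᶜ.Nonempty := by
    by_contra hne
    refine not_countable_univ ((countable_iUnion hC).mono ?_)
    exact (compl_empty_iff.1 (not_nonempty_iff_eq_empty.1 hne)).ge
  obtain ⟨c, hc, hmin⟩ := wellFounded_lt.has_min _ hne
  have hfin : ∃ n, (e c : Set (ι × β)) ⊆ C n ×ˢ univ := by
    have hdir : Directed (· ⊆ ·) fun n ↦ C n ×ˢ (univ : Set β) :=
      directed_of_isDirected_le fun n m hnm ↦ prod_mono_left (hmono hnm)
    refine hdir.exists_mem_subset_of_finset_subset_biUnion fun i hi ↦ ?_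
    have : i.1 ∈ ⋃ n, C n := by
      by_contra hi'
      exact hmin _ hi' (he c i hi)
    obtain ⟨n, hn⟩ := mem_iUnion.1 this
    exact mem_iUnion.2 ⟨n, hn, mem_univ _⟩
  obtain ⟨n, hn⟩ := hfin
  exact hc (mem_iUnion.2 ⟨n + 1, Or.inr (mem_biUnion (show e c ∈ {t | _} from hn) rfl)⟩)

/-- If no point has a countable local π-base, there is an independent family of `ℵ₁` pairs. -/
theorem exists_independent [CompactSpace X] [T2Space X] [Nonempty X] [Uncountable ι]
    (hι : ∀ a : ι, (Iio a).Countable) (h : ∀ p : X, ¬HasCountableLocalPiBase p) :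
    ∃ (O : ι → Bool → Opens X) (I : Set ι), ¬I.Countable ∧
      (∀ a, Disjoint (closure (O a false : Set X)) (closure (O a true))) ∧
      ∀ (ε : ι → Bool) (t : Finset ι), ↑t ⊆ I → (⋂ a ∈ t, (O a (ε a) : Set X)).Nonempty := by
  classical
  obtain ⟨O, hO⟩ := exists_fun_of_step (ι := ι) (P := Bool → Opens X)
    (fun a O P ↦ ∃ e : Finset (ι × Bool), (∀ i ∈ e, i.1 ∈ Iio a) ∧ (cell O e).Nonempty ∧
      Disjoint (closure (P false : Set X)) (closure (P true)) ∧
        ∀ d : Finset (ι × Bool), (∀ i ∈ d, i.1 ∈ Iio a) → e ⊆ d → (cell O d).Nonempty →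
          ∀ b, (cell O d ∩ P b).Nonempty)
    (by
      rintro a O O' hOO P ⟨e, hea, hne, hdis, hd⟩
      refine ⟨e, hea, ?_, hdis, fun d hda hed hdne ↦ ?_⟩
      · rwa [← cell_congr fun i hi ↦ hOO _ (hea i hi)]
      · rw [← cell_congr fun i hi ↦ hOO _ (hda i hi)] at hdne ⊢
        exact hd d hda hed hdne)
    (fun a O ↦ by
      obtain ⟨e, h1, h2, P, h3, h4⟩ := exists_splitting_pair h (hι a) O
      exact ⟨P, e, h1, h2, h3, h4⟩)
  choose e hea hne hdis hd using hO
  obtain ⟨e₀, he₀⟩ := exists_uncountable_fiber e hea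
  refine ⟨O, e ⁻¹' {e₀}, he₀, hdis, fun ε t ht ↦ ?_⟩
  -- Indices are added in increasing order: the pair at `a` splits every nonempty earlier cell below
  -- `e a`, and `e a = e₀` on the fiber.
  have key : (cell O (e₀ ∪ t.image fun a ↦ (a, ε a))).Nonempty := by
    induction t using Finset.induction_on_max with
    | empty =>
      obtain ⟨a, ha⟩ : (e ⁻¹' {e₀}).Nonempty := by
        by_contra hemp
        exact he₀ (not_nonempty_iff_eq_empty.1 hemp ▸ countable_empty)
      have := hne a
      rw [show e a = e₀ from ha] at this
      simpa using this
    | insert a t hat ih =>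
      have hae : e a = e₀ := ht (by simp)
      have hlt : ∀ i ∈ e₀ ∪ t.image fun a ↦ (a, ε a), i.1 ∈ Iio a := by
        intro i hi
        rcases Finset.mem_union.1 hi with hi | hi
        · exact hea a i (hae ▸ hi)
        · obtain ⟨b, hb, rfl⟩ := Finset.mem_image.1 hi
          exact hat b hb
      obtain ⟨x, hx, hxa⟩ := hd a _ hlt (hae ▸ Finset.subset_union_left)
        (ih (Subset.trans (by simp) ht)) (ε a)
      refine ⟨x, mem_iInter₂.2 fun i hi ↦ ?_⟩
      rw [Finset.image_insert, Finset.union_insert, Finset.mem_insert] at hi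
      rcases hi with rfl | hi
      · exact hxa
      · exact mem_iInter₂.1 hx i hi
  obtain ⟨x, hx⟩ := key
  refine ⟨x, mem_iInter₂.2 fun a ha ↦ mem_iInter₂.1 hx (a, ε a) ?_⟩
  exact Finset.mem_union_right _ (Finset.mem_image_of_mem _ ha)

/-- A nonempty compact Hausdorff space that is the union of countably many countably tight
subspaces has a point with a countable local π-base. -/
theorem exists_hasCountableLocalPiBase [CompactSpace X] [T2Space X] [Nonempty X]
    (Y : ℕ → Set X) (hY : ∀ n, IsCountablyTight (Y n)) (hcover : ⋃ n, Y n = univ) :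
    ∃ p : X, HasCountableLocalPiBase p := by
  classical
  by_contra! h
  obtain ⟨ι, _, _, hcard, hι⟩ := exists_uncountable_wellOrder
  have : Uncountable ι := by
    rw [← Cardinal.aleph0_lt_mk_iff, hcard]
    exact Cardinal.aleph0_lt_aleph_one
  obtain ⟨O, I, hI, hdis, hO⟩ := exists_independent (X := X) hι h
  -- The uncountable index set is cut into ω columns of length ω₁.
  have hemb : Nonempty (ℕ × ι ↪ I) := by
    rw [← Cardinal.le_def]
    have h1 : #(ℕ × ι) = ℵ₁ := by
      simp [hcard]
    rw [h1, Cardinal.aleph_one_le_iff, ← not_le, Cardinal.le_aleph0_iff_set_countable]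
    exact hI
  obtain ⟨j⟩ := hemb
  refine not_countably_tight_cover_of_independent hι
    (F := fun n a b ↦ closure (O (j (n, a)) b : Set X)) (fun _ _ _ ↦ isClosed_closure)
    (fun n a ↦ hdis _) (fun ε ↦ ?_) Y hY hcover
  let ε' : ι → Bool := fun c ↦ if hc : ∃ i, (j i : ι) = c then
    ε hc.choose.1 hc.choose.2 else false
  have hε' : ∀ i, ε' (j i) = ε i.1 i.2 := fun i ↦ by
    have hc : ∃ i', (j i' : ι) = j i := ⟨i, rfl⟩
    have : hc.choose = i := j.injective (Subtype.ext hc.choose_spec)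
    simp only [ε', dif_pos hc, this]
  have hne : (⋂ i : ℕ × ι, closure (O (j i) (ε' (j i)) : Set X)).Nonempty := by
    by_contra hemp
    obtain ⟨t, ht⟩ := isCompact_univ.elim_finite_subfamily_closed
      (fun i : ℕ × ι ↦ closure (O (j i) (ε' (j i)) : Set X)) (fun _ ↦ isClosed_closure)
      (by rw [univ_inter]; exact not_nonempty_iff_eq_empty.1 hemp)
    obtain ⟨x, hx⟩ := hO ε' (t.image fun i ↦ (j i : ι)) (by
      intro c hc
      obtain ⟨i, -, rfl⟩ := Finset.mem_image.1 (Finset.mem_coe.1 hc)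
      exact (j i).2)
    refine (Set.eq_empty_iff_forall_notMem.1 ht x) ⟨mem_univ x, mem_iInter₂.2 fun i hi ↦ ?_⟩
    exact subset_closure (mem_iInter₂.1 hx _ (Finset.mem_image_of_mem _ hi))
  obtain ⟨x, hx⟩ := hne
  refine ⟨x, mem_univ x, fun n _ a ↦ ?_⟩
  have := mem_iInter.1 hx (n, a)
  rwa [hε'] at this

end PiCharacter

/-! ### Dense sets of size continuum and the cardinality bound -/

section Density
open Set Filter Topology
open scoped Cardinal

universe u
variable {X : Type u} [TopologicalSpace X]

/-- A cover by the sets `W n ∩ Y n`, where `W n` is open and `Y n` is countably tight and dense in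
`W n`. -/
structure IsTightCover (W Y : ℕ → Set X) : Prop where
  isOpen : ∀ n, IsOpen (W n)
  le_closure : ∀ n, W n ⊆ closure (Y n)
  tight : ∀ n, IsCountablyTight (Y n)
  exists_mem : ∀ x, ∃ n, x ∈ W n ∧ x ∈ Y n

theorem HasCountableLocalPiBase.exists_countable_subset {p : X} (hp : HasCountableLocalPiBase p)
    {W Y : Set X} (hW : IsOpen W) (hWY : W ⊆ closure Y) :
    ∃ A ⊆ Y, A.Countable ∧ (p ∈ W → p ∈ closure A) := by
  classical
  obtain ⟨B, hB, hBV⟩ := hp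
  have : Nonempty X := ⟨p⟩
  -- Intersecting with `Y` discards the junk values at those `k` with `B k ∩ Y` empty.
  refine ⟨Y ∩ range fun k ↦ Classical.epsilon (· ∈ B k ∩ Y), inter_subset_left,
    (countable_range _).mono inter_subset_right, fun hpW ↦ mem_closure_iff.2 fun V hV hpV ↦ ?_⟩
  obtain ⟨k, hk⟩ := hBV (V ∩ W) (hV.inter hW) ⟨hpV, hpW⟩
  obtain ⟨b, hb⟩ := (hB k).2
  have hne : ∃ y, y ∈ B k ∩ Y := mem_closure_iff.1 (hWY (hk hb).2) _ (hB k).1 hb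
  have hspec := Classical.epsilon_spec hne
  exact ⟨_, (hk hspec.1).1, hspec.2, k, rfl⟩

theorem exists_closed_isGδ_subset [NormalSpace X] [T1Space X] {V : Set X} (hV : IsOpen V) {x : X}
    (hx : x ∈ V) : ∃ K ⊆ V, x ∈ K ∧ IsClosed K ∧ IsGδ K := by
  obtain ⟨f, hf0, hf1, -⟩ := exists_continuous_zero_one_of_isClosed isClosed_singleton
    hV.isClosed_compl (Set.disjoint_left.2 fun y (hy : y = x) hyV ↦ hyV (hy ▸ hx))
  refine ⟨f ⁻¹' {0}, fun y hy ↦ ?_, hf0 rfl, isClosed_singleton.preimage f.continuous,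
    (isClosed_singleton.isGδ).preimage f.continuous⟩
  by_contra hyV
  have h1 : f y = 1 := hf1 hyV
  have h0 : f y = 0 := hy
  exact zero_ne_one (h0.symm.trans h1)

/-- Some nonempty Gδ set is contained in the closure of a countable set. -/
theorem IsTightCover.exists_isGδ_subset_closure_countable [CompactSpace X] [T2Space X] [Nonempty X]
    {W Y : ℕ → Set X} (hWY : IsTightCover W Y) (hpi : ∀ p : X, HasCountableLocalPiBase p) :
    ∃ K : Set X, K.Nonempty ∧ IsGδ K ∧ ∃ A : Set X, A.Countable ∧ K ⊆ closure A := by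
  by_contra! hcon
  obtain ⟨ι, _, _, hcard, hι⟩ := exists_uncountable_wellOrder
  have : Uncountable ι := by
    rw [← Cardinal.aleph0_lt_mk_iff, hcard]
    exact Cardinal.aleph0_lt_aleph_one
  choose A hAY hA hxA using fun (x : X) n ↦
    (hpi x).exists_countable_subset (hWY.isOpen n) (hWY.le_closure n)
  let P := {K : Set X // K.Nonempty ∧ IsClosed K ∧ IsGδ K}
  have : Nonempty P := ⟨⟨univ, univ_nonempty, isClosed_univ, IsGδ.univ⟩⟩
  let pt : P → X := fun K ↦ K.2.1.some
  have hpt : ∀ K : P, pt K ∈ K.1 := fun K ↦ K.2.1.some_mem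
  -- Each `K a` shrinks the earlier sets and avoids the closure of the countable sets attached to
  -- their points. A limit `z` of the points lies in all `K a`, yet tightness puts it in the closure
  -- of what was attached before some stage `c`.
  obtain ⟨K, hK⟩ := exists_fun_of_step (ι := ι) (P := P)
    (fun a K p ↦ (⋂ b ∈ Iio a, (K b).1).Nonempty → p.1 ⊆ (⋂ b ∈ Iio a, (K b).1) ∧
      Disjoint p.1 (closure (⋃ b ∈ Iio a, ⋃ n, A (pt (K b)) n)))
    (by
      intro a K K' hKK p hp
      have h1 : (⋂ b ∈ Iio a, (K b).1) = ⋂ b ∈ Iio a, (K' b).1 :=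
        iInter₂_congr fun b hb ↦ by rw [hKK b hb]
      have h2 : (⋃ b ∈ Iio a, ⋃ n, A (pt (K b)) n) = ⋃ b ∈ Iio a, ⋃ n, A (pt (K' b)) n :=
        iUnion₂_congr fun b hb ↦ by rw [hKK b hb]
      rwa [h1, h2] at hp)
    (by
      intro a K
      by_cases hne : (⋂ b ∈ Iio a, (K b).1).Nonempty
      · have hG : IsGδ (⋂ b ∈ Iio a, (K b).1) := .biInter (hι a) fun b _ ↦ (K b).2.2.2
        have hC : IsClosed (⋂ b ∈ Iio a, (K b).1) := isClosed_biInter fun b _ ↦ (K b).2.2.1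
        obtain ⟨z, hz, hzA⟩ := not_subset.1 (hcon _ hne hG (⋃ b ∈ Iio a, ⋃ n, A (pt (K b)) n)
          ((hι a).biUnion fun b _ ↦ countable_iUnion fun n ↦ hA _ n))
        obtain ⟨Z, hZ, hzZ, hZC, hZG⟩ := exists_closed_isGδ_subset
          isClosed_closure.isOpen_compl hzA
        refine ⟨⟨(⋂ b ∈ Iio a, (K b).1) ∩ Z, ⟨z, hz, hzZ⟩, hC.inter hZC, hG.inter hZG⟩,
          fun _ ↦ ⟨inter_subset_left, ?_⟩⟩
        exact Set.disjoint_left.2 fun y hy ↦ hZ hy.2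
      · exact ⟨Classical.arbitrary P, fun h ↦ absurd h hne⟩)
  have hne : ∀ a, (⋂ b ∈ Iio a, (K b).1).Nonempty := by
    intro a
    induction a using WellFoundedLT.induction with
    | ind a ih =>
      by_cases ha : (Iio a).Nonempty
      · have : Nonempty (Iio a) := ha.to_subtype
        rw [biInter_eq_iInter]
        refine IsCompact.nonempty_iInter_of_directed_nonempty_isCompact_isClosed _ ?_
          (fun b ↦ (K b).2.1) (fun b ↦ (K b).2.2.1.isCompact) (fun b ↦ (K b).2.2.1)
        refine Antitone.directed_ge fun b c hbc ↦ ?_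
        rcases hbc.eq_or_lt with rfl | hbc
        · exact subset_rfl
        · exact (hK c (ih c c.2)).1.trans (biInter_subset_of_mem hbc)
      · rw [not_nonempty_iff_eq_empty.1 ha]
        simp
  have hanti : ∀ {a b}, a ≤ b → (K b).1 ⊆ (K a).1 := by
    intro a b hab
    rcases hab.eq_or_lt with rfl | hab
    · exact subset_rfl
    · exact (hK b (hne b)).1.trans (biInter_subset_of_mem hab)
  let u : Ultrafilter ι := Ultrafilter.of atTop
  obtain ⟨z, -, hz⟩ := isCompact_univ.ultrafilter_le_nhds (u.map fun a ↦ pt (K a)) (by simp)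
  have hz' : Tendsto (fun a ↦ pt (K a)) u (𝓝 z) := hz
  have hzK : ∀ a, z ∈ (K a).1 := fun a ↦ (K a).2.2.1.mem_of_tendsto hz' <|
    Ultrafilter.of_le atTop <| (eventually_ge_atTop a).mono fun b hb ↦ hanti hb (hpt _)
  obtain ⟨n, hzW, hzY⟩ := hWY.exists_mem z
  have hzcl : z ∈ closure (⋃ a, A (pt (K a)) n) := by
    refine isClosed_closure.mem_of_tendsto hz' ?_
    filter_upwards [hz' ((hWY.isOpen n).mem_nhds hzW)] with a ha
    exact closure_mono (subset_iUnion (fun a ↦ A (pt (K a)) n) a) (hxA _ n ha)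
  obtain ⟨B, hBA, hB, hzB⟩ := (hWY.tight n).exists_countable_subset
    (iUnion_subset fun a ↦ hAY _ n) hzY hzcl
  choose! α hα using fun b (hb : b ∈ B) ↦ mem_iUnion.1 (hBA hb)
  obtain ⟨c, hc⟩ := (hB.image α).exists_forall_lt hι
  refine Set.disjoint_left.1 (hK c (hne c)).2 (hzK c) (closure_mono (fun b hb ↦ ?_) hzB)
  exact mem_biUnion (hc _ (mem_image_of_mem α hb)) (mem_iUnion.2 ⟨n, hα b hb⟩)

/-- A set of size at most the continuum that is closed under continuum many operations of countable
arity. -/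
theorem exists_closed_under_operations {X : Type*} [Nonempty X] {Λ : Type} (hΛ : #Λ ≤ 𝔠)
    (φ : Λ → (ℕ → X) → X) :
    ∃ D : Set X, #D ≤ 𝔠 ∧ D.Nonempty ∧ ∀ l s, (∀ k, s k ∈ D) → φ l s ∈ D := by
  -- `D` consists of the values of well-founded terms; `none` is a constant, each `some l` an ω-ary
  -- operation.
  let β : Option Λ → Type := fun o ↦ o.elim Empty fun _ ↦ ℕ
  let ev : WType β → X := WType.elim X fun p ↦ match p with
    | ⟨none, _⟩ => Classical.arbitrary X
    | ⟨some l, s⟩ => φ l s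
  have hone : (1 : Cardinal.{0}) ≤ 𝔠 := Cardinal.one_lt_aleph0.le.trans Cardinal.aleph0_le_continuum
  have hcard : #(WType β) ≤ 𝔠 := by
    refine WType.cardinalMk_le_of_le ?_
    have hle : ∀ o, 𝔠 ^ #(β o) ≤ 𝔠 := by
      rintro (_ | l)
      · simp [β, hone]
      · simp [β]
    refine (Cardinal.sum_le_sum _ _ hle).trans ?_
    rw [Cardinal.sum_const', Cardinal.mk_option]
    refine (mul_le_mul_left (add_le_add hΛ hone) _).trans ?_
    simp
  refine ⟨range ev, ?_, ⟨_, ⟨.mk none Empty.elim, rfl⟩⟩, fun l s hs ↦ ?_⟩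
  · have := Cardinal.mk_range_le_lift (f := ev)
    have h2 : Cardinal.lift #(WType β) ≤ Cardinal.lift 𝔠 := Cardinal.lift_le.2 hcard
    simpa using this.trans h2
  · choose w hw using hs
    refine ⟨.mk (some l) w, ?_⟩
    change φ l (fun k ↦ ev (w k)) = φ l s
    simp only [hw]

/-- If moreover each point lies in a Gδ set inside the closure of a countable set, then the space
has density at most the continuum. -/
theorem IsTightCover.exists_dense_mk_le_continuum [CompactSpace X] [T2Space X] [Nonempty X]
    {W Y : ℕ → Set X} (hWY : IsTightCover W Y) (hpi : ∀ p : X, HasCountableLocalPiBase p)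
    (hG : ∀ x : X, ∃ K : Set X, x ∈ K ∧ IsGδ K ∧ ∃ A : Set X, A.Countable ∧ K ⊆ closure A) :
    ∃ D : Set X, #D ≤ 𝔠 ∧ Dense D := by
  classical
  have hG' : ∀ x : X, ∃ (U : ℕ → Set X) (A : ℕ → X), (∀ n, IsOpen (U n)) ∧ (∀ n, x ∈ U n) ∧
      ⋂ n, U n ⊆ closure (range A) := by
    intro x
    obtain ⟨K, hx, hK, A, hA, hKA⟩ := hG x
    obtain ⟨U, hU, rfl⟩ := hK.eq_iInter_nat
    have hAne : A.Nonempty := closure_nonempty_iff.1 ⟨x, hKA hx⟩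
    obtain ⟨a, rfl⟩ := hA.exists_eq_range hAne
    exact ⟨U, a, hU, mem_iInter.1 hx, hKA⟩
  choose U A hU hxU hUA using hG'
  choose B hB hBV using hpi
  -- The operations pick points of π-base sets in `Y n`, enumerate the countable set at a point,
  -- leave a finite union of sets `U d n`, and find a centre `d` for a Gδ set coded by traces on a
  -- sequence.
  let φ : (ℕ × ℕ) ⊕ ℕ ⊕ Finset (ℕ × ℕ) ⊕ (ℕ → Set ℕ) → (ℕ → X) → X :=
    Sum.elim (fun p s ↦ Classical.epsilon (· ∈ B (s 0) p.1 ∩ Y p.2)) <|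
    Sum.elim (fun k s ↦ A (s 0) k) <|
    Sum.elim (fun L s ↦ Classical.epsilon fun x ↦ ∀ i ∈ L, x ∉ U (s i.1) i.2)
      fun t s ↦ Classical.epsilon fun d ↦ (⋂ n, closure (s '' t n)) ⊆ ⋂ n, U d n
  obtain ⟨D, hD, ⟨d₀, hd₀⟩, hDφ⟩ := exists_closed_under_operations (by
    have h1 : #(ℕ → Set ℕ) ≤ 𝔠 := by simp
    have h2 : #(Finset (ℕ × ℕ)) ≤ 𝔠 := Cardinal.mk_le_aleph0.trans Cardinal.aleph0_le_continuum
    simp only [Cardinal.mk_sum, Cardinal.lift_id]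
    refine Cardinal.add_le_of_le Cardinal.aleph0_le_continuum ?_ <|
      Cardinal.add_le_of_le Cardinal.aleph0_le_continuum ?_ <|
      Cardinal.add_le_of_le Cardinal.aleph0_le_continuum h2 h1
    · exact Cardinal.mk_le_aleph0.trans Cardinal.aleph0_le_continuum
    · exact Cardinal.mk_le_aleph0.trans Cardinal.aleph0_le_continuum) φ
  refine ⟨D, hD, fun q ↦ ?_⟩
  by_contra hq
  have hctbl : ∀ x ∈ closure D, ∃ S ⊆ D, S.Countable ∧ x ∈ closure S := by
    intro x hx
    obtain ⟨n, hxW, hxY⟩ := hWY.exists_mem x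
    have hxDY : x ∈ closure (D ∩ Y n) := by
      refine mem_closure_iff.2 fun V hV hxV ↦ ?_
      obtain ⟨d, ⟨hdV, hdW⟩, hdD⟩ :=
        mem_closure_iff.1 hx (V ∩ W n) (hV.inter (hWY.isOpen n)) ⟨hxV, hxW⟩
      obtain ⟨k, hk⟩ := hBV d (V ∩ W n) (hV.inter (hWY.isOpen n)) ⟨hdV, hdW⟩
      obtain ⟨b, hb⟩ := (hB d k).2
      have hne : ∃ y, y ∈ B d k ∩ Y n :=
        mem_closure_iff.1 (hWY.le_closure n (hk hb).2) _ (hB d k).1 hb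
      have hspec := Classical.epsilon_spec hne
      exact ⟨_, (hk hspec.1).1, hDφ (.inl (k, n)) (fun _ ↦ d) fun _ ↦ hdD, hspec.2⟩
    obtain ⟨S, hS, hSc, hxS⟩ := (hWY.tight n).exists_countable_subset inter_subset_right hxY hxDY
    exact ⟨S, hS.trans inter_subset_left, hSc, hxS⟩
  -- The point `x` need not be in `D`, but the traces on a sequence in `D` of neighbourhoods shrunk
  -- inside `U x n` are among the continuum many codes, so `D` contains a substitute for `x`.
  have hcov : ∀ x ∈ closure D, ∃ d ∈ D, ∀ n, x ∈ U d n := by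
    intro x hx
    obtain ⟨S, hSD, hSc, hxS⟩ := hctbl x hx
    obtain ⟨s, rfl⟩ := hSc.exists_eq_range (closure_nonempty_iff.1 ⟨x, hxS⟩)
    have hV : ∀ n, ∃ V, IsOpen V ∧ x ∈ V ∧ closure V ⊆ U x n := fun n ↦ by
      obtain ⟨V, hV, hxV, hVU⟩ := normal_exists_closure_subset isClosed_singleton (hU x n)
        (singleton_subset_iff.2 (hxU x n))
      exact ⟨V, hV, hxV rfl, hVU⟩
    choose V hV hxV hVU using hV
    have hsub : (⋂ n, closure (s '' (s ⁻¹' V n))) ⊆ ⋂ n, U x n :=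
      iInter_mono fun n ↦ (closure_mono (image_preimage_subset s _)).trans (hVU n)
    have hmem : x ∈ ⋂ n, closure (s '' (s ⁻¹' V n)) := by
      refine mem_iInter.2 fun n ↦ mem_closure_iff.2 fun O hO hxO ↦ ?_
      obtain ⟨_, ⟨hyO, hyV⟩, k, rfl⟩ :=
        mem_closure_iff.1 hxS (O ∩ V n) (hO.inter (hV n)) ⟨hxO, hxV n⟩
      exact ⟨s k, hyO, k, hyV, rfl⟩
    have hspec := Classical.epsilon_spec
      (p := fun d ↦ (⋂ n, closure (s '' (s ⁻¹' V n))) ⊆ ⋂ n, U d n) ⟨x, hsub⟩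
    exact ⟨_, hDφ (.inr (.inr (.inr fun n ↦ s ⁻¹' V n))) s fun k ↦ hSD ⟨k, rfl⟩,
      fun n ↦ mem_iInter.1 (hspec hmem) n⟩
  have hq' : ∀ d : D, ∃ n, q ∉ U d n := by
    intro d
    by_contra! hall
    refine hq (closure_mono ?_ (hUA d (mem_iInter.2 hall)))
    rintro _ ⟨k, rfl⟩
    exact hDφ (.inr (.inl k)) (fun _ ↦ d) fun _ ↦ d.2
  choose N hN using hq'
  obtain ⟨t, ht⟩ := isClosed_closure.isCompact.elim_finite_subcover (fun d : D ↦ U d (N d))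
    (fun d ↦ hU _ _) fun x hx ↦ by
      obtain ⟨d, hd, hxd⟩ := hcov x hx
      exact mem_iUnion.2 ⟨⟨d, hd⟩, hxd _⟩
  -- Inserting `d₀` keeps the enumerated set nonempty even if `t` is empty.
  obtain ⟨s, hs⟩ := ((insert ⟨d₀, hd₀⟩ t).countable_toSet).exists_eq_range
    ⟨⟨d₀, hd₀⟩, by simp⟩
  have hidx : ∀ d ∈ t, ∃ i, s i = d := fun d hd ↦ by
    have : d ∈ range s := hs ▸ Finset.mem_coe.2 (Finset.mem_insert_of_mem hd)
    exact this
  choose! idx hidx using hidx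
  have hspec := Classical.epsilon_spec
    (p := fun x ↦ ∀ i ∈ t.image fun d ↦ (idx d, N d), x ∉ U (s i.1 : X) i.2) ⟨q, fun i hi ↦ by
      obtain ⟨d, hd, rfl⟩ := Finset.mem_image.1 hi
      simpa only [hidx d hd] using hN d⟩
  -- As `q` escapes the finite cover of `closure D`, closure under the operations puts an escaping
  -- point in `D` itself.
  have hmem := hDφ (.inr (.inr (.inl (t.image fun d ↦ (idx d, N d))))) (fun k ↦ s k) fun k ↦ (s k).2
  obtain ⟨d, hd, hxd⟩ := mem_iUnion₂.1 (ht (subset_closure hmem))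
  refine hspec _ (Finset.mem_image_of_mem _ hd) ?_
  simp only [hidx d hd]
  exact hxd

/-- A homogeneous Hausdorff space with a countable local π-base and a dense subset of size at most
the continuum has size at most the continuum. -/
theorem IsHomogeneousSpace.mk_le_continuum [T2Space X] (hX : IsHomogeneousSpace X) {p : X}
    (hp : HasCountableLocalPiBase p) {D : Set X} (hD : #D ≤ 𝔠) (hdense : Dense D) : #X ≤ 𝔠 := by
  obtain ⟨B, hB, hBV⟩ := hp
  choose h hh using hX p
  have hd : ∀ x k, ∃ d : D, (d : X) ∈ h x '' B k := fun x k ↦ by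
    obtain ⟨d, hd, hdD⟩ := hdense.inter_open_nonempty _ ((h x).isOpenMap _ (hB k).1)
      ((hB k).2.image _)
    exact ⟨⟨d, hdD⟩, hd⟩
  choose d hd using hd
  -- Two points with the same code would have a common `d x k` inside disjoint neighbourhoods.
  have hinj : Function.Injective d := by
    intro x y hxy
    by_contra hne
    obtain ⟨U, V, hU, hV, hxU, hyV, hUV⟩ := t2_separation hne
    obtain ⟨k, hk⟩ := hBV (h x ⁻¹' U ∩ h y ⁻¹' V)
      ((hU.preimage (h x).continuous).inter (hV.preimage (h y).continuous))
      ⟨by rwa [mem_preimage, hh], by rwa [mem_preimage, hh]⟩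
    obtain ⟨b, hb, hbd⟩ := hd x k
    obtain ⟨c, hc, hcd⟩ := hd y k
    refine Set.disjoint_left.1 hUV (hbd ▸ (hk hb).1 : (d x k : X) ∈ U) ?_
    rw [hxy, ← hcd]
    exact (hk hc).2
  calc #X ≤ #(ℕ → D) := Cardinal.mk_le_of_injective hinj
    _ = #D ^ Cardinal.aleph0.{u} := by simp
    _ ≤ 𝔠 ^ Cardinal.aleph0.{u} := Cardinal.power_le_power_right hD
    _ = 𝔠 := Cardinal.continuum_power_aleph0

theorem HasCountableLocalPiBase.map_homeomorph {p : X} (hp : HasCountableLocalPiBase p)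
    (h : X ≃ₜ X) : HasCountableLocalPiBase (h p) := by
  obtain ⟨B, hB, hBV⟩ := hp
  refine ⟨fun k ↦ h '' B k, fun k ↦ ⟨h.isOpenMap _ (hB k).1, (hB k).2.image _⟩, fun V hV hpV ↦ ?_⟩
  obtain ⟨k, hk⟩ := hBV (h ⁻¹' V) (hV.preimage h.continuous) hpV
  exact ⟨k, image_subset_iff.2 hk⟩

/-- Given finitely many sets, some nonempty open set is for each of them disjoint from it or
contained in its closure. -/
theorem Set.Finite.exists_isOpen_subset_closure_or_disjoint [Nonempty X] {F : Set (Set X)}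
    (hF : F.Finite) : ∃ U : Set X, IsOpen U ∧ U.Nonempty ∧
      ∀ S ∈ F, U ⊆ closure S ∨ Disjoint U S := by
  induction F, hF using Set.Finite.induction_on with
  | empty => exact ⟨univ, isOpen_univ, univ_nonempty, by simp⟩
  | @insert S F _ _ ih =>
    obtain ⟨U, hU, hne, hUF⟩ := ih
    by_cases hS : U ⊆ closure S
    · exact ⟨U, hU, hne, forall_mem_insert.2 ⟨Or.inl hS, hUF⟩⟩
    · refine ⟨U \ closure S, hU.sdiff isClosed_closure, not_subset_iff_exists_mem_notMem.1 hS,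
        forall_mem_insert.2 ⟨Or.inr ?_, fun T hT ↦ ?_⟩⟩
      · exact Set.disjoint_left.2 fun x hx hxS ↦ hx.2 (subset_closure hxS)
      · exact (hUF T hT).imp sdiff_subset.trans fun h ↦ h.mono_left sdiff_subset

theorem exists_isTightCover_of_countable [Nonempty X] {T : Set (Set X × Set X)} (hT : T.Countable)
    (hopen : ∀ p ∈ T, IsOpen p.1) (hcl : ∀ p ∈ T, p.1 ⊆ closure p.2)
    (htight : ∀ p ∈ T, IsCountablyTight p.2) (hmem : ∀ x, ∃ p ∈ T, x ∈ p.1 ∧ x ∈ p.2) :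
    ∃ W Y : ℕ → Set X, IsTightCover W Y := by
  obtain ⟨p, hp, -⟩ := hmem (Classical.arbitrary X)
  obtain ⟨f, rfl⟩ := hT.exists_eq_range ⟨p, hp⟩
  refine ⟨fun n ↦ (f n).1, fun n ↦ (f n).2, fun n ↦ hopen _ ⟨n, rfl⟩, fun n ↦ hcl _ ⟨n, rfl⟩,
    fun n ↦ htight _ ⟨n, rfl⟩, fun x ↦ ?_⟩
  obtain ⟨_, ⟨n, rfl⟩, hn⟩ := hmem x
  exact ⟨n, hn⟩

theorem exists_isTightCover_of_dense [Nonempty X] {F : Set (Set X)} (hF : F.Countable)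
    (hcover : ⋃₀ F = univ) (h : ∀ S ∈ F, Dense S ∧ IsCountablyTight S) :
    ∃ W Y : ℕ → Set X, IsTightCover W Y := by
  refine exists_isTightCover_of_countable (T := (fun S ↦ (univ, S)) '' F) (hF.image _)
    (forall_mem_image.2 fun S _ ↦ isOpen_univ)
    (forall_mem_image.2 fun S hS ↦ (h S hS).1.closure_eq.ge)
    (forall_mem_image.2 fun S hS ↦ (h S hS).2) fun x ↦ ?_
  obtain ⟨S, hS, hxS⟩ := mem_sUnion.1 (hcover.symm ▸ mem_univ x : x ∈ ⋃₀ F)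
  exact ⟨_, mem_image_of_mem _ hS, mem_univ x, hxS⟩

/-- On a suitable open `U` every piece that meets `U` is dense in it; finitely many homeomorphic
copies of `U` cover the space. -/
theorem IsHomogeneousSpace.exists_isTightCover_of_finite [CompactSpace X] [Nonempty X]
    (hX : IsHomogeneousSpace X) {F : Set (Set X)} (hF : F.Finite) (hcover : ⋃₀ F = univ)
    (h : ∀ S ∈ F, IsCountablyTight S) : ∃ W Y : ℕ → Set X, IsTightCover W Y := by
  obtain ⟨U, hU, ⟨p, hp⟩, hUF⟩ := hF.exists_isOpen_subset_closure_or_disjoint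
  choose g hg using hX p
  obtain ⟨t, ht⟩ := CompactSpace.elim_nhds_subcover (fun x ↦ g x '' U) fun x ↦
    ((g x).isOpenMap _ hU).mem_nhds ⟨p, hp, hg x⟩
  refine exists_isTightCover_of_countable
    (T := ⋃ x ∈ t, (fun S ↦ (g x '' U, g x '' S)) '' {S ∈ F | U ⊆ closure S})
    (t.countable_toSet.biUnion fun x _ ↦ (hF.countable.mono (sep_subset _ _)).image _) ?_ ?_ ?_ ?_
  · intro q hq
    obtain ⟨x, -, S, -, rfl⟩ := mem_iUnion₂.1 hq
    exact (g x).isOpenMap _ hU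
  · intro q hq
    obtain ⟨x, -, S, ⟨-, hS⟩, rfl⟩ := mem_iUnion₂.1 hq
    change g x '' U ⊆ closure (g x '' S)
    rw [← (g x).image_closure]
    exact image_mono hS
  · intro q hq
    obtain ⟨x, -, S, ⟨hS, -⟩, rfl⟩ := mem_iUnion₂.1 hq
    exact (h S hS).image_homeomorph (g x)
  · intro y
    obtain ⟨x, hx, z, hz, rfl⟩ := mem_iUnion₂.1 (ht.symm ▸ mem_univ y : y ∈ ⋃ x ∈ t, g x '' U)
    obtain ⟨S, hS, hzS⟩ := mem_sUnion.1 (hcover.symm ▸ mem_univ z : z ∈ ⋃₀ F)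
    have hUS : U ⊆ closure S :=
      (hUF S hS).resolve_right fun hd ↦ Set.disjoint_left.1 hd hz hzS
    exact ⟨_, mem_iUnion₂.2 ⟨x, hx, mem_image_of_mem _ ⟨hS, hUS⟩⟩, mem_image_of_mem _ hz,
      mem_image_of_mem _ hzS⟩

theorem IsHomogeneousSpace.mk_le_continuum_of_isTightCover [CompactSpace X] [T2Space X] [Nonempty X]
    (hX : IsHomogeneousSpace X) {W Y : ℕ → Set X} (hWY : IsTightCover W Y) : #X ≤ 𝔠 := by
  obtain ⟨p, hp⟩ := exists_hasCountableLocalPiBase Y hWY.tight (eq_univ_of_forall fun x ↦ by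
    obtain ⟨n, -, hn⟩ := hWY.exists_mem x
    exact mem_iUnion.2 ⟨n, hn⟩)
  have hpi : ∀ x : X, HasCountableLocalPiBase x := fun x ↦ by
    obtain ⟨h, rfl⟩ := hX p x
    exact hp.map_homeomorph h
  obtain ⟨K, ⟨z, hz⟩, hK, A, hA, hKA⟩ := hWY.exists_isGδ_subset_closure_countable hpi
  obtain ⟨D, hD, hdense⟩ := hWY.exists_dense_mk_le_continuum hpi fun x ↦ by
    obtain ⟨h, hh⟩ := hX x z
    refine ⟨h ⁻¹' K, by rwa [mem_preimage, hh], hK.preimage h.continuous, h ⁻¹' A,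
      hA.preimage h.injective, ?_⟩
    rw [← h.preimage_closure]
    exact preimage_mono hKA
  exact hX.mk_le_continuum hp hD hdense

end Density

theorem mainTheorem3 {X : Type*} [TopologicalSpace X] [CompactSpace X] [T2Space X]
    (hX : IsHomogeneousSpace X)
    (hcover :
      (∃ F : Set (Set X), F.Countable ∧ (⋃₀ F = Set.univ) ∧
        ∀ S ∈ F, Dense S ∧ IsCountablyTight (↥S)) ∨
      (∃ F : Set (Set X), F.Finite ∧ (⋃₀ F = Set.univ) ∧
        ∀ S ∈ F, IsCountablyTight (↥S))) :
    Cardinal.mk X ≤ Cardinal.continuum := by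
  rcases isEmpty_or_nonempty X with _ | _
  · simp
  have htight : ∃ W Y : ℕ → Set X, IsTightCover W Y := by
    rcases hcover with ⟨F, hF, hFX, h⟩ | ⟨F, hF, hFX, h⟩
    · exact exists_isTightCover_of_dense hF hFX h
    · exact hX.exists_isTightCover_of_finite hF hFX h
  obtain ⟨W, Y, hWY⟩ := htight
  exact hX.mk_le_continuum_of_isTightCover hWY
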